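/- **Notation.** Let $K=M^{-1}\mathbb C[\tau]$, where $M$ is the multiplicative set generated by all $\tau-n$, $n\in\mathbb Z$ (rational functions with poles only at integers). Then $K=\mathbb C[\tau]\oplus K_{\rm Sing}$, where $K_{\rm Sing}$ has basis $(\tau-n)^{-k-1}$, $n\in\mathbb Z$, $k\ge 0$. Let $\operatorname{Tr}\colon K\to\mathbb C$ be the sum of the residues of $F\,d\tau$ at all integers. Let $H_T=\mathbb C[T,T^{-1}]$ and $\hat H_T=H_T[\partial]$, acting on $K$ by $(TF)(\tau)=F(\tau+1)$ and $\partial=d/d\tau$, with coproduct $T\mapsto T\otimes T$, $\partial\mapsto\partial\otimes1+1\otimes\partial$ and antipode $S(T)=T^{-1}$, $S(\partial)=-\partial$; $h\mapsto S(h)\frac1\tau$ is a linear isomorphism $\hat H_T\to K_{\rm Sing}$. **Distributions and fields.** For a complex vector space $W$, a $W$-valued distribution on $K$ is a linear map $\mathcal D\colon K\to W$. It is holomorphic if it vanishes on $\mathbb C[\tau]$. The distribution with kernel $\kappa\in W\otimes K$ is $F\mapsto\operatorname{Tr}(\kappa F)$. The singular part of $\mathcal D$ is rational if there is $\kappa\in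 W\otimes K_{\rm Sing}$ (then unique) with $\mathcal D(P)=\operatorname{Tr}(\kappa P)$ for all $P\in\mathbb C[\tau]$. A field on a complex vector space $V$ is an $\operatorname{End}(V)$-valued distribution $f(\tau)$ such that for every $v\in V$ the singular part of $f(\tau)v$ is rational. Two fields $f,g$ are mutually rational if there is a nonzero polynomial $P$ such that $P(\tau_1-\tau_2)\,[f(\tau_1),g(\tau_2)]=0$ as a distribution on $K\otimes K$, where $[f(\tau_1),g(\tau_2)](F\otimes G)=f(F)g(G)-g(G)f(F)$ and multiplication by an element of $\mathbb C[\tau_1,\tau_2]$ is by transposition. Let $f^S(\tau)=f(-\tau)$ be the distribution obtained by substituting $-\tau$ for $\tau$ in the kernel, that is, $f^S(F(\tau))=-f(F(-\tau))$. **$H_T$-vertex algebras.** An $H_T$-vertex algebra is a complex vector space $V$ with a vector $1_V\in V$ and a linear map $f\mapsto Y(f,\tau)$ from $V$ to fields on $V$, with the following properties. For $h\in\hat H_T$ and $f\in V$ put $h_Vf=Y(f,\tau)\bigl(S(h)\tfrac1\tau\bigr)1_V$; let $\mathcal R_V(\tau)f$ be the holomorphic $V$-valued distribution with value $h_Vf$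 at $S(h)\frac1\tau$ for all $h\in\hat H_T$, i.e. $\mathcal R_V(\tau)=\sum_i (e_i)_V\otimes e_i^*$ for a basis $(e_i)$ of $\hat H_T$ with dual functions $e_i^*$. 1. $Y(1_V,\tau)=1_{\operatorname{End}V}$, that is, $Y(1_V,\tau)(F)=\operatorname{Tr}(F)\,1_{\operatorname{End}V}$; and for all $f\in V$, $Y(f,\tau)1_V$ is holomorphic with $Y(f,\tau)(\frac1\tau)1_V=f$. 2. For all $h\in H_T$, $f\in V$, $F\in K$: $Y(f,\tau)(S(h)F)=Y(h_Vf,\tau)(F)$. 3. For all $f,g\in V$: $Y(f,\tau)g=\mathcal R_V(\tau)\,Y^S(g,\tau)f$. Here the product of $\mathcal R_V(\tau)$ with a $V$-valued distribution with rational singular part is defined on holomorphic distributions by means of the coproduct of $\hat H_T\cong K_{\rm Sing}$, and on the distribution with kernel $v\otimes k\in V\otimes K_{\rm Sing}$ by $F\mapsto(\mathcal R_V(\tau)v)(kF)$. 4. $Y(f,\tau)$ and $Y(g,\tau)$ are mutually rational for all $f,g\in V$. **Theorem (Goddard's uniqueness).** Let $V$ be an $H_T$-vertex algebra, and let $G(\tau)$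 be a field on $V$ that is mutually rational with $Y(f,\tau)$ for every $f\in V$. Suppose that $G(\tau)1_V=\mathcal R_V(\tau)g$ for some $g\in V$. Then $G(\tau)=Y(g,\tau)$. -/

import Mathlib

open Polynomial TensorProduct

noncomputable section

namespace HTVA

/-! ### The localization `K` of the algebra of polynomial functions on `ℤ` -/

/-- The multiplicative set generated by the translates `τ - n`, `n ∈ ℤ`, of the
coordinate `τ` in the algebra `ℂ[τ]` of polynomial functions on `ℤ`. -/
def intShifts : Submonoid ℂ[X] :=
  Submonoid.closure (Set.range fun n : ℤ => (X - C (n : ℂ) : ℂ[X]))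

/-- `K = M⁻¹ ℂ[τ]`: rational functions whose only poles are at the integers. -/
abbrev K : Type := Localization intShifts

/-- A polynomial, seen as an element of `K`. -/
def ofPoly : ℂ[X] →ₐ[ℂ] K := IsScalarTower.toAlgHom ℂ ℂ[X] K

/-- The coordinate function `τ ∈ K`. -/
def tau : K := ofPoly X

/-- The element `1 / (τ - n) ^ (k + 1)` of `K`, for `p = (n, k)`. -/
def pole (p : ℤ × ℕ) : K :=
  Localization.mk 1 ⟨(X - C (p.1 : ℂ)) ^ (p.2 + 1),
    intShifts.pow_mem (Submonoid.subset_closure ⟨p.1, rfl⟩) _⟩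

/-- Universal property of `K`: an element `a` of a commutative algebra with all `a - n`, `n ∈ ℤ`,
invertible determines the substitution `F(τ) ↦ F(a)`. -/
def subst {A : Type*} [CommRing A] [Algebra ℂ A] (a : A)
    (ha : ∀ n : ℤ, IsUnit (a - algebraMap ℂ A (n : ℂ))) : K →ₐ[ℂ] A :=
  IsLocalization.liftAlgHom (M := intShifts) (S := K) (f := Polynomial.aeval a) (by
    rintro ⟨y, hy⟩
    change IsUnit (Polynomial.aeval a y)
    induction hy using Submonoid.closure_induction with
    | mem x hx => obtain ⟨n, rfl⟩ := hx; simpa using ha n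
    | one => simp
    | mul x y _ _ hx hy => simpa using hx.mul hy)

theorem subst_ofPoly {A : Type*} [CommRing A] [Algebra ℂ A] (a : A)
    (ha : ∀ n : ℤ, IsUnit (a - algebraMap ℂ A (n : ℂ))) (p : ℂ[X]) :
    subst a ha (ofPoly p) = Polynomial.aeval a p :=
  IsLocalization.lift_eq _ _

theorem subst_tau {A : Type*} [CommRing A] [Algebra ℂ A] (a : A)
    (ha : ∀ n : ℤ, IsUnit (a - algebraMap ℂ A (n : ℂ))) : subst a ha tau = a := by
  rw [tau, subst_ofPoly, aeval_X]

theorem ofPoly_X_sub (n : ℤ) :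
    ofPoly (X - C (n : ℂ)) = tau - algebraMap ℂ K (n : ℂ) := by
  rw [map_sub]
  exact congrArg _ (ofPoly.commutes (n : ℂ))

theorem isUnit_tau_sub (n : ℤ) : IsUnit (tau - algebraMap ℂ K (n : ℂ)) := by
  rw [← ofPoly_X_sub]
  exact IsLocalization.map_units K
    (⟨X - C (n : ℂ), Submonoid.subset_closure ⟨n, rfl⟩⟩ : intShifts)

theorem mul_pole (p : ℤ × ℕ) : (tau - algebraMap ℂ K (p.1 : ℂ)) ^ (p.2 + 1) * pole p = 1 := by
  rw [← ofPoly_X_sub, ← map_pow]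
  have h := IsLocalization.mk'_spec' K (1 : ℂ[X])
    (⟨(X - C (p.1 : ℂ)) ^ (p.2 + 1),
      intShifts.pow_mem (Submonoid.subset_closure ⟨p.1, rfl⟩) _⟩ : intShifts)
  rw [map_one] at h
  rw [pole, Localization.mk_eq_mk']
  exact h

/-- Algebra homomorphisms out of `K` are determined by their value at `τ`. -/
theorem algHom_ext_tau {A : Type*} [CommRing A] [Algebra ℂ A] {f g : K →ₐ[ℂ] A}
    (h : f tau = g tau) : f = g := by
  apply IsLocalization.algHom_ext intShifts
  apply Polynomial.algHom_ext
  exact h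

/-- The translation `F(τ) ↦ F(τ + n)`, that is, the action of `T ^ n`. -/
def shift (n : ℤ) : K →ₐ[ℂ] K :=
  subst (tau + algebraMap ℂ K (n : ℂ)) (fun m => by
    have e : tau + algebraMap ℂ K (n : ℂ) - algebraMap ℂ K (m : ℂ) =
        tau - algebraMap ℂ K ((m - n : ℤ) : ℂ) := by
      rw [Int.cast_sub, (algebraMap ℂ K).map_sub]
      ring
    rw [e]
    exact isUnit_tau_sub _)

/-- The antipodal homomorphism of `K`, with `S τ = -τ`. -/
def antipodeK : K →ₐ[ℂ] K :=
  subst (-tau) (fun m => by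
    have e : -tau - algebraMap ℂ K (m : ℂ) = -(tau - algebraMap ℂ K ((-m : ℤ) : ℂ)) := by
      rw [Int.cast_neg, (algebraMap ℂ K).map_neg]
      ring
    rw [e]
    exact (isUnit_tau_sub _).neg)

/-- The homomorphism `F ↦ F + ε F'` to the dual numbers over `K`. -/
def tangent : K →ₐ[ℂ] TrivSqZeroExt K K :=
  subst (TrivSqZeroExt.inl tau + TrivSqZeroExt.inr (1 : K)) (fun m => by
    rw [TrivSqZeroExt.isUnit_iff_isUnit_fst]
    have e : (TrivSqZeroExt.inl tau + TrivSqZeroExt.inr (1 : K) -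
        algebraMap ℂ (TrivSqZeroExt K K) (m : ℂ)).fst = tau - algebraMap ℂ K (m : ℂ) := by
      simp
    rw [e]
    exact isUnit_tau_sub m)

/-- The derivative `∂ = d/dτ` on `K`. -/
def derivK : K →ₗ[ℂ] K where
  toFun F := (tangent F).snd
  map_add' _ _ := by simp
  map_smul' _ _ := by simp

theorem tangent_fst (F : K) : (tangent F).fst = F := by
  have h : (TrivSqZeroExt.fstHom ℂ K K).comp tangent = AlgHom.id ℂ K :=
    algHom_ext_tau (by simp [tangent, subst_tau])
  exact DFunLike.congr_fun h F

theorem derivK_mul (F G : K) : derivK (F * G) = F * derivK G + G * derivK F := by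
  have h : derivK (F * G) = (tangent F * tangent G).snd := by rw [← map_mul]; rfl
  rw [h, TrivSqZeroExt.snd_mul, tangent_fst, tangent_fst]
  simp [derivK, mul_comm]

/-! ### Principal parts, the trace and the singular part -/

theorem algebraMap_laurent (z : ℂ) : algebraMap ℂ (LaurentSeries ℂ) z = HahnSeries.C z := by
  rw [← HahnSeries.ofPowerSeries_C]
  rfl

/-- The Laurent expansion at the integer `n`, in the local coordinate `t = τ - n`. -/
def laurentAt (n : ℤ) : K →ₐ[ℂ] LaurentSeries ℂ :=
  subst (HahnSeries.single 1 1 + algebraMap ℂ (LaurentSeries ℂ) (n : ℂ)) (fun m => by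
    rw [isUnit_iff_ne_zero]
    intro h
    have h1 := congrArg (fun s : LaurentSeries ℂ => s.coeff 1) h
    have hC : ∀ z : ℂ, (algebraMap ℂ (LaurentSeries ℂ) z).coeff 1 = 0 := fun z => by
      rw [algebraMap_laurent]
      exact HahnSeries.coeff_single_of_ne one_ne_zero
    rw [HahnSeries.coeff_sub, HahnSeries.coeff_add, hC, hC] at h1
    simp at h1)

theorem eventually_holo (m : ℂ[X]) (hm : m ∈ intShifts) :
    {n : ℤ | ¬ ∃ u : PowerSeries ℂ, IsUnit u ∧
      laurentAt n (ofPoly m) = HahnSeries.ofPowerSeries ℤ ℂ u}.Finite := by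
  induction hm using Submonoid.closure_induction with
  | mem x hx =>
    obtain ⟨a, rfl⟩ := hx
    refine (Set.finite_singleton a).subset fun n hn => ?_
    by_contra hna
    refine hn ⟨PowerSeries.X + PowerSeries.C ((n : ℂ) - a), ?_, ?_⟩
    · rw [PowerSeries.isUnit_iff_constantCoeff]
      simpa [sub_eq_zero] using hna
    · rw [laurentAt, subst_ofPoly]
      simp [HahnSeries.ofPowerSeries_X, add_sub_assoc]
  | one => exact Set.finite_empty.subset fun n hn => hn ⟨1, isUnit_one, by simp⟩
  | mul x y _ _ hx hy =>
    refine (hx.union hy).subset fun n hn => ?_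
    by_contra h
    simp only [Set.mem_union, Set.mem_ofPred_eq, not_or, not_not] at h
    obtain ⟨⟨u, hu, hu'⟩, v, hv, hv'⟩ := h
    exact hn ⟨u * v, hu.mul hv, by rw [map_mul, map_mul, hu', hv', map_mul]⟩

theorem laurentAt_ofPoly (n : ℤ) (f : ℂ[X]) :
    ∃ u : PowerSeries ℂ, laurentAt n (ofPoly f) = HahnSeries.ofPowerSeries ℤ ℂ u := by
  refine ⟨Polynomial.eval₂ (PowerSeries.C) (PowerSeries.X + PowerSeries.C (n : ℂ)) f, ?_⟩
  rw [laurentAt, subst_ofPoly, Polynomial.hom_eval₂, Polynomial.aeval_def, map_add,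
    HahnSeries.ofPowerSeries_X, HahnSeries.ofPowerSeries_C, algebraMap_laurent]
  rfl

theorem coeff_ofPowerSeries_neg (u : PowerSeries ℂ) (k : ℕ) :
    (HahnSeries.ofPowerSeries ℤ ℂ u).coeff (-(k + 1 : ℤ)) = 0 := by
  rw [HahnSeries.ofPowerSeries_apply]
  apply HahnSeries.embDomain_of_notMem_range
  rintro ⟨m, hm⟩
  have : (m : ℤ) = -(k + 1 : ℤ) := hm
  lia

theorem polar_finite (F : K) :
    (Function.support fun p : ℤ × ℕ => (laurentAt p.1 F).coeff (-(p.2 + 1 : ℤ))).Finite := by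
  have h1 : {n : ℤ | ∃ k : ℕ, (laurentAt n F).coeff (-(k + 1 : ℤ)) ≠ 0}.Finite := by
    obtain ⟨⟨f, m⟩, hfm⟩ := IsLocalization.surj intShifts F
    refine (eventually_holo m m.2).subset ?_
    rintro n ⟨k, hk⟩ ⟨u, hu, hun⟩
    obtain ⟨v, hv⟩ := laurentAt_ofPoly n f
    obtain ⟨w, rfl⟩ := hu
    have e : laurentAt n F * HahnSeries.ofPowerSeries ℤ ℂ (w : PowerSeries ℂ)
        = HahnSeries.ofPowerSeries ℤ ℂ v := by
      rw [← hun, ← hv, ← map_mul]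
      exact congrArg _ hfm
    have e2 : laurentAt n F = HahnSeries.ofPowerSeries ℤ ℂ (v * (↑w⁻¹ : PowerSeries ℂ)) := by
      rw [map_mul, ← e, mul_assoc, ← map_mul, Units.mul_inv, map_one, mul_one]
    exact hk (by rw [e2, coeff_ofPowerSeries_neg])
  have h2 : ∀ n : ℤ, {k : ℕ | (laurentAt n F).coeff (-(k + 1 : ℤ)) ≠ 0}.Finite := by
    intro n
    refine (Set.finite_Iio ((-(laurentAt n F).order).toNat + 1)).subset fun k hk => ?_
    by_contra hlt
    refine hk (HahnSeries.coeff_eq_zero_of_lt_order ?_)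
    simp only [Set.mem_Iio, not_lt] at hlt
    lia
  refine (h1.biUnion fun n _ => (h2 n).image (Prod.mk n)).subset ?_
  rintro ⟨n, k⟩ hp
  simp only [Set.mem_iUnion]
  exact ⟨n, ⟨k, hp⟩, k, hp, rfl⟩

/-- The principal part of `F ∈ K`: the coefficients `c (n, k)` in the partial fraction expansion
`F = polynomial + ∑ c (n, k) / (τ - n) ^ (k + 1)`. -/
def polar : K →ₗ[ℂ] (ℤ × ℕ →₀ ℂ) where
  toFun F := Finsupp.ofSupportFinite _ (polar_finite F)
  map_add' F G := by
    ext p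
    simp [Finsupp.ofSupportFinite_coe]
  map_smul' c F := by
    ext p
    change (laurentAt p.1 (c • F)).coeff _ = c * (laurentAt p.1 F).coeff _
    rw [Algebra.smul_def, map_mul, AlgHom.commutes, algebraMap_laurent, HahnSeries.C_mul_eq_smul]
    rfl

/-- The trace `Tr F`: the sum of the residues of `F(τ) dτ` at all integers. -/
def trace : K →ₗ[ℂ] ℂ :=
  (Finsupp.lsum ℂ fun p : ℤ × ℕ => if p.2 = 0 then LinearMap.id else 0).comp polar

/-- `K_Sing`, the span of the `1 / (τ - n) ^ (k + 1)`. -/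
def KSing : Submodule ℂ K := Submodule.span ℂ (Set.range pole)

/-! ### The Hopf algebras `H_T` and `Ĥ_T` and their action on `K` -/

/-- `H_T = ℂ[T, T⁻¹]`. -/
abbrev HT : Type := LaurentPolynomial ℂ

/-- `Ĥ_T = H_T[∂]`. -/
abbrev HatHT : Type := Polynomial HT

theorem shift_tau (n : ℤ) : shift n tau = tau + algebraMap ℂ K (n : ℂ) := subst_tau _ _

/-- The action of `H_T` on `K`. -/
def actHT : HT →ₐ[ℂ] Module.End ℂ K :=
  AddMonoidAlgebra.lift ℂ (Module.End ℂ K) ℤ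
    { toFun := fun n => (shift n.toAdd).toLinearMap
      map_one' := by
        have : shift 0 = AlgHom.id ℂ K := algHom_ext_tau (by simp [shift_tau])
        apply LinearMap.ext
        intro x
        simp [this]
      map_mul' := fun m n => by
        have : shift (m.toAdd + n.toAdd) = (shift m.toAdd).comp (shift n.toAdd) :=
          algHom_ext_tau (by simp [shift_tau]; ring)
        apply LinearMap.ext
        intro x
        simp [this] }

/-- The antipode of `H_T`, `T ^ n ↦ T ^ (-n)`. -/
def antipodeHT : HT →ₗ[ℂ] HT := HopfAlgebra.antipode ℂ

/-- `h ↦ S(h) (1 / τ)` for `h ∈ Ĥ_T`, where `S T = T⁻¹` and `S ∂ = -∂`. -/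
def alpha : HatHT →ₗ[ℂ] K where
  toFun h := h.sum fun k a => actHT (antipodeHT a) (((-derivK) ^ k) (pole (0, 0)))
  map_add' h h' := Polynomial.sum_add_index h h' _ (by simp) (by simp)
  map_smul' c h := by
    rw [Polynomial.sum_smul_index' _ _ _ (by simp)]
    simp [Polynomial.sum_def, Finset.smul_sum]

/-- The basis `T ^ n ∂^(k)` of `Ĥ_T`, where `∂^(k) = ∂ ^ k / k!` and `p = (n, k)`. -/
def hatBasis (p : ℤ × ℕ) : HatHT :=
  Polynomial.monomial p.2 (((p.2.factorial : ℂ)⁻¹) • (LaurentPolynomial.T p.1 : HT))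

theorem actHT_T (n : ℤ) (F : K) : actHT (LaurentPolynomial.T n) F = shift n F := by
  rw [actHT, LaurentPolynomial.T, AddMonoidAlgebra.lift_single, one_smul]
  rfl

theorem derivK_tau_sub (n : ℤ) : derivK (tau - algebraMap ℂ K (n : ℂ)) = 1 := by
  simp [derivK, tangent, subst_tau]

theorem pole_eq_of_mul {p : ℤ × ℕ} {F : K}
    (h : (tau - algebraMap ℂ K (p.1 : ℂ)) ^ (p.2 + 1) * F = 1) : F = pole p := by
  calc F = ((tau - algebraMap ℂ K (p.1 : ℂ)) ^ (p.2 + 1) * pole p) * F := by rw [mul_pole, one_mul]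
    _ = pole p * ((tau - algebraMap ℂ K (p.1 : ℂ)) ^ (p.2 + 1) * F) := by ring
    _ = pole p := by rw [h, mul_one]

theorem pole_succ (n : ℤ) (k : ℕ) : pole (n, k + 1) = pole (n, k) * pole (n, 0) := by
  symm
  apply pole_eq_of_mul
  have h1 := mul_pole (n, k)
  have h2 := mul_pole (n, 0)
  simp only [zero_add, pow_one] at h1 h2 ⊢
  rw [pow_succ]
  linear_combination (tau - algebraMap ℂ K (n : ℂ)) * pole (n, 0) * h1 + h2

theorem derivK_pole (n : ℤ) (k : ℕ) :
    derivK (pole (n, k)) = -((k + 1 : ℂ) • pole (n, k + 1)) := by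
  have h0 : derivK (pole (n, 0)) = -(pole (n, 0) * pole (n, 0)) := by
    have h1 : (tau - algebraMap ℂ K (n : ℂ)) * pole (n, 0) = 1 := by
      simpa using mul_pole (n, 0)
    have h2 := congrArg derivK h1
    have h3 : derivK 1 = 0 := by simp [derivK]
    rw [derivK_mul, derivK_tau_sub, h3] at h2
    linear_combination pole (n, 0) * h2 - derivK (pole (n, 0)) * h1
  induction k with
  | zero => rw [h0, pole_succ]; simp
  | succ k ih =>
    rw [pole_succ n k, derivK_mul, h0, ih, pole_succ n (k + 1), pole_succ n k]
    simp only [Algebra.smul_def]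
    push_cast
    ring_nf

theorem neg_derivK_pow_pole (k : ℕ) :
    ((-derivK) ^ k) (pole (0, 0)) = (k.factorial : ℂ) • pole (0, k) := by
  induction k with
  | zero => simp
  | succ k ih =>
    rw [pow_succ', Module.End.mul_apply, ih, map_smul, LinearMap.neg_apply, derivK_pole, neg_neg,
      smul_smul, Nat.factorial_succ]
    push_cast
    rw [mul_comm]

theorem shift_pole (n m : ℤ) (k : ℕ) : shift n (pole (m, k)) = pole (m - n, k) := by
  apply pole_eq_of_mul
  have h := congrArg (shift n) (mul_pole (m, k))
  rw [map_mul, map_pow, map_sub, AlgHom.commutes, shift_tau, map_one] at h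
  rw [← h, Int.cast_sub, (algebraMap ℂ K).map_sub]
  congr 2
  ring

/-- The basis element `T ^ n ∂^(k)` corresponds to `1 / (τ - n) ^ (k + 1)`. -/
theorem alpha_hatBasis (p : ℤ × ℕ) : alpha (hatBasis p) = pole p := by
  obtain ⟨n, k⟩ := p
  change (hatBasis (n, k)).sum (fun k a => actHT (antipodeHT a) (((-derivK) ^ k) (pole (0, 0)))) = _
  rw [hatBasis, Polynomial.sum_monomial_index _ _ (by simp)]
  have hS : antipodeHT (LaurentPolynomial.T n) = LaurentPolynomial.T (-n) :=
    LaurentPolynomial.antipode_T n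
  simp only [map_smul, hS, neg_derivK_pow_pole, LinearMap.smul_apply, actHT_T, shift_pole,
    smul_smul]
  rw [mul_inv_cancel₀ (by exact_mod_cast k.factorial_ne_zero), one_smul]
  simp

/-! ### Distributions and fields -/

/-- `W`-valued distributions on `K` (in one variable). -/
abbrev Dist (W : Type*) [AddCommGroup W] [Module ℂ W] := K →ₗ[ℂ] W

section

variable {V : Type*} [AddCommGroup V] [Module ℂ V]

/-- The `V`-valued distribution `f(τ) v`. -/
def applyVec (f : Dist (Module.End ℂ V)) (v : V) : Dist V := (LinearMap.applyₗ v).comp f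

/-- The antipodal distribution `D(-τ)`, obtained from `D(τ)` by the substitution `τ ↦ -τ` in the
kernel. As `Tr (S F) = - Tr F`, its value at `F` is `- D (S F)`. -/
def antipodal (D : Dist (Module.End ℂ V)) : Dist (Module.End ℂ V) :=
  -(D.comp antipodeK.toLinearMap)

/-- The rational distribution `F ↦ Tr (κ F)` with kernel `κ ∈ V ⊗ K_Sing`. -/
def ratDist : V ⊗[ℂ] KSing →ₗ[ℂ] Dist V :=
  TensorProduct.lift (LinearMap.mk₂ ℂ
    (fun v k => (LinearMap.toSpanSingleton ℂ V v).comp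
      (trace.comp (LinearMap.mulLeft ℂ (k : K))))
    (fun v w k => by ext F; simp) (fun c v k => by ext F; simpa using smul_comm _ _ _)
    (fun v k l => by ext F; simp [add_mul, add_smul])
    (fun c v k => by ext F; simp [mul_smul]))

/-- The singular part of `D` is rational, with kernel `κ`. -/
def HasSingKernel (D : Dist V) (κ : V ⊗[ℂ] KSing) : Prop :=
  ∀ G : ℂ[X], D (ofPoly G) = ratDist κ (ofPoly G)

/-- A field on `V`: an `End V`-valued distribution such that for all `v` the singular part of
`f(τ) v` is rational. -/
def IsField (f : Dist (Module.End ℂ V)) : Prop :=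
  ∀ v : V, ∃ κ, HasSingKernel (applyVec f v) κ

/-- The commutator `[f(τ₁), g(τ₂)]`, a distribution on `K ⊗ K`. -/
def commDist (f g : Dist (Module.End ℂ V)) : K ⊗[ℂ] K →ₗ[ℂ] Module.End ℂ V :=
  TensorProduct.lift (LinearMap.mk₂ ℂ (fun F G => f F * g G - g G * f F)
    (fun F F' G => by simp only [map_add, add_mul, mul_add]; abel)
    (fun c F G => by simp only [map_smul, smul_mul_assoc, mul_smul_comm, smul_sub])
    (fun F G G' => by simp only [map_add, add_mul, mul_add]; abel)
    (fun c F G => by simp only [map_smul, smul_mul_assoc, mul_smul_comm, smul_sub]))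

/-- The twisted coproduct `P ↦ P(τ₁ - τ₂)`. -/
def twistedCoproduct : ℂ[X] →ₐ[ℂ] K ⊗[ℂ] K :=
  Polynomial.aeval (tau ⊗ₜ[ℂ] (1 : K) - (1 : K) ⊗ₜ[ℂ] tau)

/-- `f` and `g` are mutually rational: `P(τ₁ - τ₂) [f(τ₁), g(τ₂)] = 0` for some polynomial
`P ≠ 0`. -/
def MutuallyRational (f g : Dist (Module.End ℂ V)) : Prop :=
  ∃ P : ℂ[X], P ≠ 0 ∧ ∀ z : K ⊗[ℂ] K, commDist f g (twistedCoproduct P * z) = 0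

/-! ### Exponential operators

Let `A` assign to each `h ∈ Ĥ_T` an operator on `V`. The exponential operator
`𝓡(τ) = ∑ A(eᵢ) ⊗ eᵢ*`, where `eᵢ` is a basis of `Ĥ_T` with dual functions `eᵢ*`, is computed in
the basis `T ^ n ∂^(k)`. The element `T ^ n ∂^(k)` of `Ĥ_T` corresponds to
`1 / (τ - n) ^ (k + 1) ∈ K_Sing`, so that `eᵢ*` reads off a coefficient of the principal part. -/

/-- `𝓡(τ) v`: the holomorphic distribution with value `A(h) v` at `S(h) (1 / τ)`. -/
def expVec (A : HatHT →ₗ[ℂ] Module.End ℂ V) : V →ₗ[ℂ] Dist V where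
  toFun v := (Finsupp.linearCombination ℂ fun p => A (hatBasis p) v).comp polar
  map_add' v w := by
    ext F
    simp [Finsupp.linearCombination_apply, Finsupp.sum, Finset.sum_add_distrib]
  map_smul' c v := by
    ext F
    simp [Finsupp.linearCombination_apply, Finsupp.sum, Finset.smul_sum, smul_comm c]

/-- The product of `𝓡(τ)` with the holomorphic part of `D`. Holomorphic distributions are
functions on `Ĥ_T`, and are multiplied by means of the coproduct
`T ^ n ∂^(k) ↦ ∑_{i + j = k} T ^ n ∂^(i) ⊗ T ^ n ∂^(j)`. -/
def expMulHol (A : HatHT →ₗ[ℂ] Module.End ℂ V) (D : Dist V) : Dist V :=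
  (Finsupp.linearCombination ℂ fun p : ℤ × ℕ =>
    ∑ ij ∈ Finset.HasAntidiagonal.antidiagonal p.2, A (hatBasis (p.1, ij.1)) (D (pole (p.1, ij.2)))).comp polar

/-- The product of `𝓡(τ)` with a rational distribution with kernel in `V ⊗ K_Sing`: for the
kernel `v ⊗ k` it is `F ↦ (𝓡(τ) v) (k F)`. -/
def expMulRat (A : HatHT →ₗ[ℂ] Module.End ℂ V) : V ⊗[ℂ] KSing →ₗ[ℂ] Dist V :=
  TensorProduct.lift (LinearMap.mk₂ ℂ
    (fun v k => (expVec A v).comp (LinearMap.mulLeft ℂ (k : K)))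
    (fun v w k => by ext F; simp) (fun c v k => by ext F; simp)
    (fun v k l => by ext F; simp [add_mul]) (fun c v k => by ext F; simp))

open Classical in
/-- The kernel of the singular part of `D`, when this is rational. -/
def singKernel (D : Dist V) : V ⊗[ℂ] KSing :=
  if h : ∃ κ, HasSingKernel D κ then h.choose else 0

/-- The product `𝓡(τ) D(τ)`, for `D` with rational singular part. -/
def expMul (A : HatHT →ₗ[ℂ] Module.End ℂ V) (D : Dist V) : Dist V :=
  expMulHol A D + expMulRat A (singKernel D)

/-! ### `H_T`-vertex algebras -/

/-- The operators `h_V f = f_[h] 1_V = Y(f, τ)(S(h) (1 / τ)) 1_V`, for `h ∈ Ĥ_T`. -/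
def stateOp (Y : V →ₗ[ℂ] Dist (Module.End ℂ V)) (vac : V) : HatHT →ₗ[ℂ] Module.End ℂ V :=
  LinearMap.mk₂ ℂ (fun h f => Y f (alpha h) vac)
    (by simp) (by simp) (by simp) (by simp)

end

/-- An `H_T`-vertex algebra structure on the vector space `V`. -/
structure HTVertexAlgebra (V : Type*) [AddCommGroup V] [Module ℂ V] where
  /-- the vacuum `1_V` -/
  vac : V
  /-- the state-field correspondence `f ↦ Y(f, τ)` -/
  Y : V →ₗ[ℂ] Dist (Module.End ℂ V)
  isField : ∀ f, IsField (Y f)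
  /-- `Y(1_V, τ) = 1_{End V}` -/
  vacuum_left : ∀ F : K, Y vac F = trace F • (1 : Module.End ℂ V)
  /-- `Y(f, τ) 1_V` is holomorphic -/
  vacuum_holo : ∀ (f : V) (G : ℂ[X]), Y f (ofPoly G) vac = 0
  /-- the constant term of `Y(f, τ) 1_V` is `f` -/
  vacuum_const : ∀ f, Y f (pole (0, 0)) vac = f
  /-- `h_K Y(f, τ) = Y(h_V f, τ)` for `h ∈ H_T`, where `(h_K D)(F) = D(S(h) F)` -/
  covariance : ∀ (h : HT) (f : V),
    (Y f).comp (actHT (antipodeHT h)) = Y (stateOp Y vac (Polynomial.C h) f)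
  /-- `Y(f, τ) g = 𝓡_V(τ) Y^S(g, τ) f` -/
  skew : ∀ f g : V, applyVec (Y f) g = expMul (stateOp Y vac) (applyVec (antipodal (Y g)) f)
  mutuallyRational : ∀ f g : V, MutuallyRational (Y f) (Y g)

/-- `𝓡_V(τ) g` for an `H_T`-vertex algebra `V`. -/
def HTVertexAlgebra.expState {V : Type*} [AddCommGroup V] [Module ℂ V] (A : HTVertexAlgebra V)
    (g : V) : Dist V :=
  expVec (stateOp A.Y A.vac) g

end HTVA

end

namespace HTVA

/-! ### Partial fractions in `K` -/

/-! Put `D = G - Y(g)`. It is a field, it is mutually rational with every `Y(f)`, and it kills the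
vacuum, because `Y(g) 1_V` is also `𝓡_V g` (`HTVertexAlgebra.applyVec_vac`). It remains to show that
such a `D` vanishes.

Choose `P ≠ 0` with `P(τ₁ - τ₂) [D(τ₁), Y(f, τ₂)] = 0`, apply this to the vacuum and test it on `F ⊗
1/τ₂`. The term with `D` next to the vacuum is zero. In the other term, every positive power of `τ₂`
in `P(τ₁ - τ₂)` turns `1/τ₂` into a polynomial, and `Y(f) 1_V` kills polynomials. Only `P(τ₁)`
survives, and since `Y(f)(1/τ) 1_V = f`, the result is `P(τ) D(τ) f = 0`
(`commDist_twistedCoproduct_pole`).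

Being annihilated by `P` is not enough in general: a delta distribution at a non-integral point is
killed by a nonzero polynomial. Rationality of the singular part excludes this
(`HasSingKernel.eq_zero`). It makes `D f` vanish on the multiples of some `m ∈ M` in `ℂ[τ]`, while
the annihilator of `D f` contains a polynomial prime to `M`. Bézout then splits every `F ∈ K` into
two pieces, each killed by `D f`. -/

theorem polar_apply (F : K) (p : ℤ × ℕ) :
    polar F p = (laurentAt p.1 F).coeff (-(p.2 + 1 : ℤ)) := rfl

theorem polar_ofPoly (Q : ℂ[X]) : polar (ofPoly Q) = 0 := by
  ext p
  obtain ⟨u, hu⟩ := laurentAt_ofPoly p.1 Q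
  rw [polar_apply, hu, coeff_ofPowerSeries_neg]
  rfl

theorem trace_ofPoly (Q : ℂ[X]) : trace (ofPoly Q) = 0 := by
  rw [trace, LinearMap.comp_apply, polar_ofPoly, map_zero]

theorem laurentAt_tau_sub (n m : ℤ) :
    laurentAt n (tau - algebraMap ℂ K (m : ℂ)) =
      HahnSeries.ofPowerSeries ℤ ℂ (PowerSeries.X + PowerSeries.C ((n : ℂ) - m)) := by
  rw [map_sub, AlgHom.commutes, laurentAt, subst_tau, map_add, HahnSeries.ofPowerSeries_X,
    HahnSeries.ofPowerSeries_C, algebraMap_laurent, algebraMap_laurent, map_sub, add_sub_assoc]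

theorem polar_pole (p : ℤ × ℕ) : polar (pole p) = Finsupp.single p 1 := by
  obtain ⟨m, k⟩ := p
  ext ⟨n, l⟩
  rw [polar_apply]
  have h := congrArg (laurentAt n) (mul_pole (m, k))
  rw [map_mul, map_pow, map_one, laurentAt_tau_sub] at h
  dsimp only at h ⊢
  by_cases hnm : n = m
  · subst hnm
    have e : laurentAt n (pole (n, k)) = HahnSeries.single (-(k + 1 : ℤ)) (1 : ℂ) := by
      rw [sub_self, map_zero, add_zero, HahnSeries.ofPowerSeries_X, HahnSeries.single_pow] at h
      -- At its own pole `τ - n` is the local coordinate `t`, so the expansion is the inverse of `t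
      -- ^ (k + 1)`.
      refine mul_left_cancel₀ (left_ne_zero_of_mul_eq_one h) ?_
      rw [h, HahnSeries.single_mul_single]
      simp
    rw [e]
    by_cases hkl : l = k
    · rw [hkl, HahnSeries.coeff_single_same, Finsupp.single_eq_same]
    · rw [HahnSeries.coeff_single_of_ne (by lia), Finsupp.single_eq_of_ne (by simp [hkl])]
  · rw [Finsupp.single_eq_of_ne (by simp [hnm])]
    -- Away from the pole `τ - m` expands with constant term `n - m ≠ 0`; its inverse is a power
    -- series and has no polar coefficients.
    have hu : IsUnit (PowerSeries.X + PowerSeries.C ((n : ℂ) - m)) := by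
      rw [PowerSeries.isUnit_iff_constantCoeff]
      simpa [sub_eq_zero] using hnm
    obtain ⟨w, hw⟩ := hu.pow (k + 1)
    rw [← map_pow, ← hw] at h
    have e : laurentAt n (pole (m, k)) =
        HahnSeries.ofPowerSeries ℤ ℂ (↑w⁻¹ : PowerSeries ℂ) := by
      refine mul_left_cancel₀ (left_ne_zero_of_mul_eq_one h) ?_
      rw [h, ← map_mul, Units.mul_inv, map_one]
    rw [e, coeff_ofPowerSeries_neg]

theorem tau_sub_mul_pole (n : ℤ) : (tau - algebraMap ℂ K (n : ℂ)) * pole (n, 0) = 1 := by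
  simpa using mul_pole (n, 0)

theorem tau_mul_pole : tau * pole (0, 0) = 1 := by
  simpa using tau_sub_mul_pole 0

theorem pole_mul_pole {m n : ℤ} (h : m ≠ n) :
    pole (m, 0) * pole (n, 0) = ((m : ℂ) - n)⁻¹ • (pole (m, 0) - pole (n, 0)) := by
  have hmn : (m : ℂ) - n ≠ 0 := by simpa [sub_eq_zero] using h
  rw [eq_inv_smul_iff₀ hmn, Algebra.smul_def, map_sub]
  linear_combination pole (m, 0) * tau_sub_mul_pole n - pole (n, 0) * tau_sub_mul_pole m

/-- `ℂ[τ] + K_Sing`. -/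
noncomputable def polyAddSing : Submodule ℂ K := LinearMap.range ofPoly.toLinearMap ⊔ KSing

theorem ofPoly_mem_polyAddSing (Q : ℂ[X]) : ofPoly Q ∈ polyAddSing :=
  Submodule.mem_sup_left ⟨Q, rfl⟩

theorem pole_mem_polyAddSing (p : ℤ × ℕ) : pole p ∈ polyAddSing :=
  Submodule.mem_sup_right (Submodule.subset_span ⟨p, rfl⟩)

/-- For distinct poles, `pole_mul_pole` separates one factor at `m` from the factor at `n`; what
stays mixed has lower order at `m`, hence the induction on `k`. -/
theorem pole_mul_pole_mem (n m : ℤ) (k : ℕ) : pole (m, k) * pole (n, 0) ∈ polyAddSing := by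
  by_cases h : m = n
  · subst h
    rw [← pole_succ]
    exact pole_mem_polyAddSing _
  · induction k with
    | zero =>
      rw [pole_mul_pole h]
      exact Submodule.smul_mem _ _
        (Submodule.sub_mem _ (pole_mem_polyAddSing _) (pole_mem_polyAddSing _))
    | succ k ih =>
      rw [pole_succ, mul_assoc, pole_mul_pole h, mul_smul_comm, mul_sub, ← pole_succ]
      exact Submodule.smul_mem _ _ (Submodule.sub_mem _ (pole_mem_polyAddSing _) ih)

theorem ofPoly_mul_pole_mem (Q : ℂ[X]) (n : ℤ) : ofPoly Q * pole (n, 0) ∈ polyAddSing := by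
  -- Division with remainder by `τ - n`: the remainder `Q(n)` is the residue.
  have h : ofPoly Q * pole (n, 0) =
      ofPoly (Q /ₘ (X - C (n : ℂ))) + Q.eval (n : ℂ) • pole (n, 0) := by
    conv_lhs => rw [← Polynomial.modByMonic_add_div Q (X - C (n : ℂ))]
    rw [Polynomial.modByMonic_X_sub_C_eq_C_eval, map_add, map_mul, ofPoly_X_sub,
      Algebra.smul_def, show ofPoly (C (Q.eval (n : ℂ))) = algebraMap ℂ K (Q.eval (n : ℂ)) from
        ofPoly.commutes _]
    linear_combination ofPoly (Q /ₘ (X - C (n : ℂ))) * tau_sub_mul_pole n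
  rw [h]
  exact Submodule.add_mem _ (ofPoly_mem_polyAddSing _)
    (Submodule.smul_mem _ _ (pole_mem_polyAddSing _))

theorem mul_pole_mem {F : K} (hF : F ∈ polyAddSing) (n : ℤ) :
    F * pole (n, 0) ∈ polyAddSing := by
  have h : polyAddSing ≤ polyAddSing.comap (LinearMap.mulRight ℂ (pole (n, 0))) := by
    refine sup_le ?_ (Submodule.span_le.2 ?_)
    · rintro _ ⟨Q, rfl⟩
      exact ofPoly_mul_pole_mem Q n
    · rintro _ ⟨⟨m, k⟩, rfl⟩
      exact pole_mul_pole_mem n m k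
  exact h hF

theorem mem_polyAddSing_of_mul {m : ℂ[X]} (hm : m ∈ intShifts) {F : K}
    (hF : F * ofPoly m ∈ polyAddSing) : F ∈ polyAddSing := by
  induction hm using Submonoid.closure_induction generalizing F with
  | mem x hx =>
    obtain ⟨n, rfl⟩ := hx
    have h := mul_pole_mem hF n
    dsimp only at h
    rwa [ofPoly_X_sub, mul_assoc, tau_sub_mul_pole, mul_one] at h
  | one => simpa using hF
  | mul x y _ _ hx hy => exact hx (hy (by rwa [mul_assoc, ← map_mul]))

/-- Every element of `K` becomes polynomial after multiplication by an element of `M`. -/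
theorem exists_mul_eq_ofPoly (F : K) : ∃ m ∈ intShifts, ∃ Q, F * ofPoly m = ofPoly Q := by
  obtain ⟨⟨Q, m⟩, h⟩ := IsLocalization.surj intShifts F
  exact ⟨m, m.2, Q, h⟩

theorem polyAddSing_eq_top : polyAddSing = ⊤ := by
  rw [eq_top_iff]
  intro F _
  obtain ⟨m, hm, Q, h⟩ := exists_mul_eq_ofPoly F
  exact mem_polyAddSing_of_mul hm (h ▸ ofPoly_mem_polyAddSing Q)

/-- Distributions agreeing on polynomials and on all `1 / (τ - n) ^ (k + 1)` are equal. -/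
theorem dist_ext {W : Type*} [AddCommGroup W] [Module ℂ W] {D E : Dist W}
    (hpoly : ∀ Q, D (ofPoly Q) = E (ofPoly Q)) (hpole : ∀ p, D (pole p) = E (pole p)) :
    D = E := by
  have h : polyAddSing ≤ LinearMap.eqLocus D E := by
    refine sup_le ?_ (Submodule.span_le.2 ?_)
    · rintro _ ⟨Q, rfl⟩
      exact hpoly Q
    · rintro _ ⟨p, rfl⟩
      exact hpole p
  exact LinearMap.ext fun F => h (polyAddSing_eq_top ▸ Submodule.mem_top)

section

variable {V : Type*} [AddCommGroup V] [Module ℂ V]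

/-! ### The fields `Y(g)` on the vacuum -/

theorem expVec_apply (A : HatHT →ₗ[ℂ] Module.End ℂ V) (v : V) (F : K) :
    expVec A v F = Finsupp.linearCombination ℂ (fun p => A (hatBasis p) v) (polar F) := rfl

theorem applyVec_apply (f : Dist (Module.End ℂ V)) (v : V) (F : K) : applyVec f v F = f F v := rfl

/-- Both sides are holomorphic, and at a pole they agree by the definition of `stateOp`, since
`alpha` carries `hatBasis p` to `pole p`. -/
theorem HTVertexAlgebra.applyVec_vac (A : HTVertexAlgebra V) (g : V) :
    applyVec (A.Y g) A.vac = A.expState g := by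
  refine dist_ext (fun Q => ?_) fun p => ?_
  · rw [applyVec_apply, A.vacuum_holo, HTVertexAlgebra.expState, expVec_apply, polar_ofPoly,
      map_zero]
  · rw [applyVec_apply, HTVertexAlgebra.expState, expVec_apply, polar_pole,
      Finsupp.linearCombination_single, one_smul, ← alpha_hatBasis]
    rfl

/-! ### Distributions with rational singular part annihilated by a polynomial -/

theorem ratDist_tmul (v : V) (k : KSing) (F : K) :
    ratDist (v ⊗ₜ[ℂ] k) F = trace ((k : K) * F) • v := rfl

/-- `m` is a common denominator of `κ`: it makes the kernel polynomial, and polynomials have trace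
zero. -/
theorem exists_ratDist_mul_eq_zero (κ : V ⊗[ℂ] KSing) :
    ∃ m ∈ intShifts, ∀ Q, ratDist κ (ofPoly (m * Q)) = 0 := by
  induction κ with
  | zero => exact ⟨1, one_mem _, fun Q => by simp⟩
  | tmul v k =>
    obtain ⟨m, hm, R, hR⟩ := exists_mul_eq_ofPoly (k : K)
    refine ⟨m, hm, fun Q => ?_⟩
    rw [ratDist_tmul, map_mul ofPoly, ← mul_assoc, hR, ← map_mul, trace_ofPoly, zero_smul]
  | add x y hx hy =>
    obtain ⟨m, hm, hx⟩ := hx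
    obtain ⟨n, hn, hy⟩ := hy
    refine ⟨m * n, mul_mem hm hn, fun Q => ?_⟩
    rw [map_add, LinearMap.add_apply, mul_assoc, hx, mul_left_comm, hy, add_zero]

/-- The polynomials `p` with `p D = 0`. -/
def polyAnnihilator {W : Type*} [AddCommGroup W] [Module ℂ W] (D : Dist W) : Ideal ℂ[X] where
  carrier := {p | ∀ F, D (ofPoly p * F) = 0}
  add_mem' hp hq F := by rw [map_add, add_mul, map_add, hp, hq, add_zero]
  zero_mem' F := by simp
  smul_mem' c p hp F := by
    rw [smul_eq_mul, map_mul ofPoly, mul_comm (ofPoly c), mul_assoc, hp]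

/-- A distribution annihilated by a nonzero polynomial is annihilated by a polynomial prime to
all `τ - n`. -/
theorem exists_mem_polyAnnihilator_coprime {W : Type*} [AddCommGroup W] [Module ℂ W]
    {D : Dist W} {P : ℂ[X]} (hP : P ≠ 0) (hD : P ∈ polyAnnihilator D) :
    ∃ p ∈ polyAnnihilator D, ∀ m ∈ intShifts, IsCoprime p m := by
  obtain ⟨p, hp⟩ := IsPrincipalIdealRing.principal (polyAnnihilator D)
  have hmem : ∀ q, q ∈ polyAnnihilator D ↔ p ∣ q := fun q => by
    rw [hp]
    exact Ideal.mem_span_singleton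
  have hp0 : p ≠ 0 := fun h => hP (zero_dvd_iff.1 (h ▸ (hmem P).1 hD))
  have hpD := (hmem p).2 dvd_rfl
  refine ⟨p, hpD, fun m hm => ?_⟩
  induction hm using Submonoid.closure_induction with
  | mem x hx =>
    obtain ⟨n, rfl⟩ := hx
    refine ((Polynomial.prime_X_sub_C (n : ℂ)).coprime_iff_not_dvd.2 ?_).symm
    rintro ⟨q, hq⟩
    -- As `τ - n` is invertible on `K`, a factor `X - n` of the generator `p` can be dropped without
    -- leaving the annihilator.
    have hqD : q ∈ polyAnnihilator D := fun F => by
      have h := hpD (pole (n, 0) * F)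
      rwa [hq, map_mul ofPoly, ofPoly_X_sub, show (tau - algebraMap ℂ K (n : ℂ)) * ofPoly q *
        (pole (n, 0) * F) = ((tau - algebraMap ℂ K (n : ℂ)) * pole (n, 0)) * (ofPoly q * F) by
          ring, tau_sub_mul_pole, one_mul] at h
    obtain ⟨r, hr⟩ := (hmem q).1 hqD
    -- From `p = (X - n) q` and `q = p r` it follows that `(X - n) r = 1`, which is absurd.
    refine (Polynomial.prime_X_sub_C (n : ℂ)).not_isUnit (IsUnit.of_mul_eq_one r ?_)
    refine mul_left_cancel₀ hp0 ?_
    linear_combination -(X - C (n : ℂ)) * hr - hq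
  | one => exact isCoprime_one_right
  | mul x y _ _ hx hy => exact hx.mul_right hy

/-- `m` clears the denominators of `κ` and `n` those of `F`. With `a p + b m n = 1`, `F` is a
multiple of `p` in `K`, which `D` kills, plus a polynomial multiple of `m`, which the kernel kills.
-/
theorem HasSingKernel.eq_zero {D : Dist V} {κ : V ⊗[ℂ] KSing} (hκ : HasSingKernel D κ)
    {P : ℂ[X]} (hP : P ≠ 0) (hD : P ∈ polyAnnihilator D) : D = 0 := by
  obtain ⟨m, hm, hmκ⟩ := exists_ratDist_mul_eq_zero κ
  obtain ⟨p, hp, hcop⟩ := exists_mem_polyAnnihilator_coprime hP hD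
  refine LinearMap.ext fun F => ?_
  obtain ⟨n, hn, Q, hQ⟩ := exists_mul_eq_ofPoly F
  obtain ⟨a, b, hab⟩ := hcop (m * n) (mul_mem hm hn)
  have hF : F = ofPoly p * (ofPoly a * F) + ofPoly (m * (b * Q)) := by
    have h := congrArg ofPoly hab
    simp only [map_add, map_mul, map_one] at h ⊢
    linear_combination -F * h + ofPoly b * ofPoly m * hQ
  rw [hF, map_add, hp, hκ, hmκ, add_zero, LinearMap.zero_apply]

/-! ### Mutually rational fields -/

theorem commDist_tmul (f g : Dist (Module.End ℂ V)) (F H : K) :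
    commDist f g (F ⊗ₜ[ℂ] H) = f F * g H - g H * f F := rfl

theorem commDist_sub (f f' g : Dist (Module.End ℂ V)) (z : K ⊗[ℂ] K) :
    commDist (f - f') g z = commDist f g z - commDist f' g z := by
  induction z with
  | zero => simp
  | tmul F H =>
    simp only [commDist_tmul, LinearMap.sub_apply, sub_mul, mul_sub]
    abel
  | add x y hx hy =>
    simp only [map_add, hx, hy]
    abel

theorem MutuallyRational.sub {f f' g : Dist (Module.End ℂ V)} (h : MutuallyRational f g)
    (h' : MutuallyRational f' g) : MutuallyRational (f - f') g := by
  obtain ⟨P, hP, h⟩ := h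
  obtain ⟨P', hP', h'⟩ := h'
  refine ⟨P * P', mul_ne_zero hP hP', fun z => ?_⟩
  have h₁ : commDist f g (twistedCoproduct (P * P') * z) = 0 := by
    rw [map_mul twistedCoproduct, mul_assoc, h]
  have h₂ : commDist f' g (twistedCoproduct (P * P') * z) = 0 := by
    rw [mul_comm P P', map_mul twistedCoproduct, mul_assoc, h']
  rw [commDist_sub, h₁, h₂, sub_zero]

theorem IsField.sub {f f' : Dist (Module.End ℂ V)} (h : IsField f) (h' : IsField f') :
    IsField (f - f') := by
  intro v
  obtain ⟨κ, hκ⟩ := h v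
  obtain ⟨κ', hκ'⟩ := h' v
  refine ⟨κ - κ', fun Q => ?_⟩
  rw [map_sub, LinearMap.sub_apply, ← hκ Q, ← hκ' Q]
  rfl

/-! ### Commutators evaluated on the vacuum -/

theorem mul_sub_tmul {R : Type*} [CommRing R] [Algebra ℂ R] (z : R ⊗[ℂ] R) (x F H : R) :
    z * (x ⊗ₜ[ℂ] 1 - 1 ⊗ₜ[ℂ] x) * (F ⊗ₜ[ℂ] H) =
      z * ((x * F) ⊗ₜ[ℂ] H) - z * (F ⊗ₜ[ℂ] (x * H)) := by
  rw [mul_assoc, sub_mul, Algebra.TensorProduct.tmul_mul_tmul,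
    Algebra.TensorProduct.tmul_mul_tmul, one_mul, one_mul, mul_sub]

theorem commDist_twistedCoproduct_mul_X (D E : Dist (Module.End ℂ V)) (P : ℂ[X]) (F H : K) :
    commDist D E (twistedCoproduct (P * X) * (F ⊗ₜ[ℂ] H)) =
      commDist D E (twistedCoproduct P * ((tau * F) ⊗ₜ[ℂ] H)) -
        commDist D E (twistedCoproduct P * (F ⊗ₜ[ℂ] (tau * H))) := by
  rw [← map_sub, map_mul twistedCoproduct, show twistedCoproduct X = _ from aeval_X _]
  exact congrArg _ (mul_sub_tmul _ _ _ _)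

theorem commDist_twistedCoproduct_ofPoly {D E : Dist (Module.End ℂ V)} {v : V}
    (hD : applyVec D v = 0) (hE : ∀ Q, E (ofPoly Q) v = 0) (P Q : ℂ[X]) (F : K) :
    commDist D E (twistedCoproduct P * (F ⊗ₜ[ℂ] ofPoly Q)) v = 0 := by
  induction P using Polynomial.induction_on' generalizing F Q with
  | add p q hp hq => rw [map_add, add_mul, map_add, LinearMap.add_apply, hp, hq, add_zero]
  | monomial n c =>
    induction n generalizing F Q with
    | zero =>
      have hF : D F v = 0 := LinearMap.congr_fun hD F
      rw [Polynomial.monomial_zero_left, ← Polynomial.algebraMap_eq, AlgHom.commutes,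
        ← Algebra.smul_def, map_smul, commDist_tmul]
      simp [hF, hE]
    -- Multiplication by `τ₁ - τ₂` changes `F` to `τ F` or `Q` to `X Q`; the second slot stays
    -- polynomial, so the hypothesis covers both terms.
    | succ n ih =>
      rw [← Polynomial.monomial_mul_X, commDist_twistedCoproduct_mul_X, LinearMap.sub_apply,
        ih, tau, ← map_mul ofPoly, ih, sub_zero]

theorem commDist_twistedCoproduct_pole {D E : Dist (Module.End ℂ V)} {v : V}
    (hD : applyVec D v = 0) (hE : ∀ Q, E (ofPoly Q) v = 0) (P : ℂ[X]) (F : K) :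
    commDist D E (twistedCoproduct P * (F ⊗ₜ[ℂ] pole (0, 0))) v =
      D (ofPoly P * F) (E (pole (0, 0)) v) := by
  induction P using Polynomial.induction_on' generalizing F with
  | add p q hp hq =>
    simp only [map_add, add_mul, LinearMap.add_apply, hp, hq]
  | monomial n c =>
    induction n generalizing F with
    | zero =>
      have hF : D F v = 0 := LinearMap.congr_fun hD F
      rw [Polynomial.monomial_zero_left, ← Polynomial.algebraMap_eq, AlgHom.commutes,
        AlgHom.commutes, ← Algebra.smul_def, ← Algebra.smul_def, map_smul, map_smul,
        commDist_tmul]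
      simp [hF]
    -- The `τ₂` term has `τ · (1/τ) = 1` in its second slot, a polynomial, so it vanishes; the `τ₁`
    -- term moves the factor `τ` into `F`.
    | succ n ih =>
      rw [← Polynomial.monomial_mul_X, commDist_twistedCoproduct_mul_X, LinearMap.sub_apply,
        ih, tau_mul_pole, ← map_one ofPoly, commDist_twistedCoproduct_ofPoly hD hE, sub_zero,
        map_mul ofPoly, mul_assoc]
      rfl

/-- A field that annihilates the vacuum and is mutually rational with all `Y(f, τ)` vanishes. -/
theorem HTVertexAlgebra.eq_zero_of_applyVec_vac (A : HTVertexAlgebra V)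
    {D : Dist (Module.End ℂ V)} (hD : IsField D) (hrat : ∀ f, MutuallyRational D (A.Y f))
    (hvac : applyVec D A.vac = 0) : D = 0 := by
  refine LinearMap.ext fun F => LinearMap.ext fun f => ?_
  obtain ⟨P, hP, hcomm⟩ := hrat f
  obtain ⟨κ, hκ⟩ := hD f
  -- What remains is that `P` annihilates the distribution `D(τ) f`.
  refine LinearMap.congr_fun (hκ.eq_zero hP fun H => ?_) F
  have h := commDist_twistedCoproduct_pole hvac (A.vacuum_holo f) P H
  rw [hcomm, A.vacuum_const] at h
  exact h.symm

end

end HTVA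

theorem mainTheorem7 {V : Type*} [AddCommGroup V] [Module ℂ V] (A : HTVA.HTVertexAlgebra V)
    (G : HTVA.Dist (Module.End ℂ V)) (hG : HTVA.IsField G)
    (hrat : ∀ f : V, HTVA.MutuallyRational G (A.Y f))
    (g : V) (hvac : HTVA.applyVec G A.vac = A.expState g) :
    G = A.Y g := by
  refine sub_eq_zero.1 (A.eq_zero_of_applyVec_vac (hG.sub (A.isField g))
    (fun f => (hrat f).sub (A.mutuallyRational g f)) ?_)
  refine LinearMap.ext fun F => ?_
  exact sub_eq_zero.2 (LinearMap.congr_fun (hvac.trans (A.applyVec_vac g).symm) F)
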